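/- An episodic MDP $M=(\mathcal S,\mathcal A,R,P,\mu_0,H)$ has finite state and action sets, a reward function $R$, transition probabilities $P(\cdot\mid s,a)$, an initial state distribution $\mu_0$ and episode length $H$ (time steps $0,\dots,H-1$). Its diameter is $$D=\max_{s\in\mathcal S}\ \min\{T:\ \exists\, s_0,a_0,s_1,a_1,\dots,s_T=s,\ \mu_0(s_0)>0,\ P(s_{t+1}\mid s_t,a_t)>0\ \forall t<T\}.$$ Let $\mathcal L$ be the family of $\varepsilon$-greedy learners with a Q-table $Q_t\in\mathbb R^{\mathcal S\times\mathcal A}$: in state $s$ the learner takes $a^*=\arg\max_a Q_t(s,a)$ (ties broken by some fixed rule) with probability $1-\varepsilon$, and a uniformly random action of $\mathcal A\setminus\{a^*\}$ with probability $\varepsilon$; after the experience $e_t=(s_t,a_t,r_t,s_{t+1})$ it updates $Q_{t+1}=f(Q_t,e_t)$, where $f$ modifies only the entry $(s_t,a_t)$ and, for all $Q_t,s_t,a_t,s_{t+1}$, there are rewards $r_t$ for which the action $a_t$ becomes strictly first, becomes strictly last, or keeps its rank in $Q_{t+1}(s_t,\cdot)$, respectively. A Level 3 teacher observes the past, the current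 state and the action chosen by the learner, cannot override that action, may choose every reward arbitrarily, and may choose the initial state $s_0$ of every episode with $\mu_0(s_0)>0$ and every next state $s_{t+1}$ with $P(s_{t+1}\mid s_t,a_t)>0$. For a target policy $\pi^\dagger:\mathcal S\to\mathcal A$ and an initial table $Q_0$, let $\mathrm{METaL}(M,L,Q_0,\pi^\dagger)$ be the infimum, over Level 3 teachers, of the expected number of time steps until the learner's greedy policy equals $\pi^\dagger$, and let $\mathrm{TDim}(L,\mathcal M)=\sup_{\pi^\dagger,\,Q_0,\,M\in\mathcal M}\mathrm{METaL}(M,L,Q_0,\pi^\dagger)$. Then, for a greedy learner, the Level 3 teaching dimension is $\Theta(SAH)$: there are absolute constants $c,C>0$ such that for every state set of size $S$ and action set of size $A$, every learner $L\in\mathcal L$ with $\varepsilon=0$, all $H$ and all $D<H$, the family $\mathcal M$ of all MDPs on these sets with episode length $H$ and diameter $D$ satisfies $$\mathrm{TDim}(L,\mathcal M)\le C\,SAH,\qquad\text{and, if } A\ge 2 \text{ and } S\ge D+2,\qquad c\,SAH\le \mathrm{TDim}(L,\mathcal M).$$ -/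

import Mathlib

open scoped NNReal ENNReal

noncomputable section

namespace RLTeaching

/-- A Q-table on the state space `S` and the action space `A`. -/
abbrev QTable (S A : Type*) := S → A → ℝ

/-- A single experience `e = (s, a, r, s')`. -/
structure Experience (S A : Type*) where
  state : S
  action : A
  reward : ℝ
  next : S

/-- An episodic Markov decision process `(S, A, R, P, μ₀, H)`. -/
structure MDP (S A : Type*) where
  /-- the reward function -/
  R : S → A → ℝ
  /-- the transition probabilities `P(· | s, a)` -/
  P : S → A → PMF S
  /-- the initial state distribution -/
  μ₀ : PMF S
  /-- the episode length -/
  H : ℕ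

/-- `M.Reach n s`: there is a path `s₀, a₀, s₁, a₁, …, s_n = s` with `μ₀(s₀) > 0` and
`P(s_{t+1} | s_t, a_t) > 0` for all `t < n`. -/
def MDP.Reach {S A : Type*} (M : MDP S A) : ℕ → S → Prop
  | 0, s => 0 < M.μ₀ s
  | n + 1, s => ∃ s' a, M.Reach n s' ∧ 0 < M.P s' a s

/-- The diameter: the largest, over all states `s`, of the minimum length of a path from an initial
state to `s` (it is `⊤` if some state cannot be reached). -/
def MDP.diameter {S A : Type*} (M : MDP S A) : ℕ∞ :=
  ⨆ s : S, ⨅ (n : ℕ) (_ : M.Reach n s), (n : ℕ∞)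

/-- The learner family: `ε`-greedy Q-learning agents with a controllable Q-table. -/
structure Learner (S A : Type*) where
  /-- the exploration probability -/
  ε : ℝ≥0
  ε_le_one : ε ≤ 1
  /-- the greedy action `argmax_a Q(s, a)`, ties being broken by an arbitrary fixed rule -/
  greedy : QTable S A → S → A
  le_greedy : ∀ (Q : QTable S A) (s : S) (b : A), Q s b ≤ Q s (greedy Q s)
  /-- the learning update `Q_{t+1} = f(Q_t, e_t)` -/
  update : QTable S A → Experience S A → QTable S A
  /-- only the entry `(s_t, a_t)` is modified -/
  update_of_ne : ∀ (Q : QTable S A) (e : Experience S A) (s : S) (a : A),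
    ¬ (s = e.state ∧ a = e.action) → update Q e s a = Q s a
  /-- some reward makes `a` the (unambiguously) first action at `s` -/
  exists_first : ∀ (Q : QTable S A) (s : S) (a : A) (s' : S), ∃ r : ℝ,
    ∀ b, b ≠ a → update Q ⟨s, a, r, s'⟩ s b < update Q ⟨s, a, r, s'⟩ s a
  /-- some reward makes `a` the (unambiguously) last action at `s` -/
  exists_last : ∀ (Q : QTable S A) (s : S) (a : A) (s' : S), ∃ r : ℝ,
    ∀ b, b ≠ a → update Q ⟨s, a, r, s'⟩ s a < update Q ⟨s, a, r, s'⟩ s b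
  /-- some reward leaves the rank of `a` at `s` unchanged -/
  exists_unchanged : ∀ (Q : QTable S A) (s : S) (a : A) (s' : S), ∃ r : ℝ, ∀ b,
    (update Q ⟨s, a, r, s'⟩ s b < update Q ⟨s, a, r, s'⟩ s a ↔ Q s b < Q s a) ∧
    (update Q ⟨s, a, r, s'⟩ s a < update Q ⟨s, a, r, s'⟩ s b ↔ Q s a < Q s b)

/-- The law of a coin that shows `true` with probability `ε`. -/
def exploreLaw (ε : ℝ≥0) (h : ε ≤ 1) : PMF Bool :=
  PMF.ofFintype (fun b => if b then (ε : ℝ≥0∞) else 1 - (ε : ℝ≥0∞)) (by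
    simpa using add_tsub_cancel_of_le (by exact_mod_cast h : (ε : ℝ≥0∞) ≤ 1))

open Classical in
/-- The behavior policy: the greedy action `a*` with probability `1 - ε`, and a uniformly random
element of `A \ {a*}` with probability `ε` (if `A = {a*}`, then `a*` is the only choice). -/
def Learner.behavior {S A : Type*} [Fintype A] (L : Learner S A) (Q : QTable S A) (s : S) :
    PMF A :=
  (exploreLaw L.ε L.ε_le_one).bind fun explore =>
    if h : explore = true ∧ (Finset.univ.erase (L.greedy Q s)).Nonempty then
      PMF.uniformOfFinset (Finset.univ.erase (L.greedy Q s)) h.2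
    else PMF.pure (L.greedy Q s)

/-- A Level 3 teacher strategy for `M`. It may depend on the whole past, given as the list of all
past experiences, the most recent one first (the Q-table is a function of it and of the data of the
instance), and on the current state and on the action just chosen by the learner. It may randomize;
in particular it may refrain from overriding the draws of the MDP. The reward is arbitrary, initial
and next states must be supported by the MDP. -/
structure Level3Teacher {S A : Type*} (M : MDP S A) where
  /-- the first state of the next episode -/
  init : List (Experience S A) → PMF S
  /-- the reward and the next state, given the past, the current state and the action -/
  reply : List (Experience S A) → S → A → PMF (ℝ × S)
  init_supported : ∀ h, ∀ s ∈ (init h).support, 0 < M.μ₀ s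
  reply_supported : ∀ h s a, ∀ x ∈ (reply h s a).support, 0 < M.P s a x.2

/-- The configuration of the teaching protocol at a time step: the past experiences (most recent
first), the current Q-table and the current state. -/
structure Config (S A : Type*) where
  past : List (Experience S A)
  Q : QTable S A
  state : S

/-- The learner's current greedy policy is the target policy. -/
def Learned {S A : Type*} (L : Learner S A) (π : S → A) (c : Config S A) : Prop :=
  L.greedy c.Q = π

/-- The configuration after the experience `e`: the Q-table is updated, and the current state is
the next state of `e`, unless `e` completes an episode; then a new episode starts. -/
def afterExperience {S A : Type*} {M : MDP S A} (L : Learner S A) (τ : Level3Teacher M)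
    (c : Config S A) (e : Experience S A) : PMF (Config S A) :=
  if M.H ∣ (e :: c.past).length then
    (τ.init (e :: c.past)).map fun s => ⟨e :: c.past, L.update c.Q e, s⟩
  else PMF.pure ⟨e :: c.past, L.update c.Q e, e.next⟩

open Classical in
/-- One time step of the teaching protocol. Teaching stops as soon as the target policy has been
learned: from then on the configuration is frozen. -/
def protocolStep {S A : Type*} [Fintype A] {M : MDP S A} (L : Learner S A) (π : S → A)
    (τ : Level3Teacher M) (c : Config S A) : PMF (Config S A) :=
  if Learned L π c then PMF.pure c
  else (L.behavior c.Q c.state).bind fun a =>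
    (τ.reply c.past c.state a).bind fun x =>
      afterExperience L τ c ⟨c.state, a, x.1, x.2⟩

/-- The law of the configuration after `n` time steps, from the initial Q-table `Q₀`. -/
def configLaw {S A : Type*} [Fintype A] {M : MDP S A} (L : Learner S A) (Q₀ : QTable S A)
    (π : S → A) (τ : Level3Teacher M) : ℕ → PMF (Config S A)
  | 0 => (τ.init []).map fun s => ⟨[], Q₀, s⟩
  | n + 1 => (configLaw L Q₀ π τ n).bind (protocolStep L π τ)

/-- The expected teaching length `E[T]`, where `T ∈ ℕ ∪ {∞}` is the first time at which the
learner's policy is the target policy: `E[T] = ∑ₙ ℙ(T > n)`, and `T > n` means that the target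
policy has not been learned by time `n`. -/
def expectedLength {S A : Type*} [Fintype A] {M : MDP S A} (L : Learner S A) (Q₀ : QTable S A)
    (π : S → A) (τ : Level3Teacher M) : ℝ≥0∞ :=
  ∑' n : ℕ, (configLaw L Q₀ π τ n).toOuterMeasure {c | ¬ Learned L π c}

/-- The minimum expected teaching length of the instance `(M, L, Q₀, π)` for Level 3 teachers. -/
def METaL {S A : Type*} [Fintype A] (M : MDP S A) (L : Learner S A) (Q₀ : QTable S A)
    (π : S → A) : ℝ≥0∞ :=
  ⨅ τ : Level3Teacher M, expectedLength L Q₀ π τ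

/-- The Level 3 teaching dimension of the learner `L` with respect to a family of MDPs. -/
def TDim {S A : Type*} [Fintype A] (L : Learner S A) (F : Set (MDP S A)) : ℝ≥0∞ :=
  ⨆ (π : S → A) (Q₀ : QTable S A) (M ∈ F), METaL M L Q₀ π

/-- The family of all MDPs on `S` and `A` with episode length `H` and diameter `D`. -/
def mdpFamily (S A : Type*) (H D : ℕ) : Set (MDP S A) :=
  {M | M.H = H ∧ M.diameter = (D : ℕ∞)}

end RLTeaching

end

/-!
A greedy learner does not randomize, so a Level 3 teacher can enforce any sequence of configurations
that is compatible with the supports of the MDP, and teaching takes no longer than such a sequence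
that ends in the target policy (`METaL_le_of_canReach`).

*Upper bound.* Layer the states by their distance from the initial states; there are at most
`D + 1 ≤ H` layers. A state is *taught* when the target action is strictly first at it and at all
states below it. In an untaught state the greedy action is either still needed to lead the learner
to an untaught state in the next layer (it is *pending*), and then the teacher goes there without
changing any ranking; or it is not, and then the teacher demotes it to the last place (or, if
nothing is pending and it is the target action, promotes it). The second case lowers a potential that is at
most `2 |A|` at each state (`exists_reward_potential_lt`). It occurs once in every episode, as an
episode is longer than the descent through the layers (`canFinishEpisode_potential_lt`), so that
`2 |S| |A|` episodes suffice (`METaL_le`).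

*Lower bound.* Take a chain of `D + 1` states along one action `a`, let every other transition
lead to a sink and every state off the chain be initial, and let `a` be the target action everywhere, ranked last at first
(`le_METaL_chainMDP`). The action `a` is not chosen at a state before all others have been demoted
there, and every demotion leads to the sink for the rest of the episode, so about
`(|S| - 1) (|A| - 1)` episodes are needed. The last of them may be cut short, which matters only for
`|S| = |A| = 2`, where two absorbing initial states give the bound (`le_METaL_absorbingMDP`). Both
estimates are instances of `le_METaL`, in which a measure of the remaining work drops by at most one
per episode, whatever a possibly randomized teacher does.
-/

namespace RLTeaching

variable {S A : Type*}

/-! ### Protocol steps with a greedy learner -/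

theorem Learner.behavior_eq_pure [Fintype A] (L : Learner S A) (hε : L.ε = 0) (Q : QTable S A)
    (s : S) : L.behavior Q s = PMF.pure (L.greedy Q s) := by
  have h : exploreLaw L.ε L.ε_le_one = PMF.pure false := by
    ext b
    cases b <;> simp [exploreLaw, hε]
  simp [Learner.behavior, h, PMF.pure_bind]

/-- The transitions `c → c'` of the protocol with the greedy learner `L` that a Level 3 teacher for
`M` can enforce. -/
def CanStep (M : MDP S A) (L : Learner S A) (c c' : Config S A) : Prop :=
  ∃ (r : ℝ) (s' : S), 0 < M.P c.state (L.greedy c.Q c.state) s' ∧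
    c'.past = ⟨c.state, L.greedy c.Q c.state, r, s'⟩ :: c.past ∧
    c'.Q = L.update c.Q ⟨c.state, L.greedy c.Q c.state, r, s'⟩ ∧
    if M.H ∣ c.past.length + 1 then 0 < M.μ₀ c'.state else c'.state = s'

/-- `CanReach M L n c c'`: some teacher can lead the greedy learner from `c` to `c'` in `n` time
steps (if teaching does not stop before). -/
def CanReach (M : MDP S A) (L : Learner S A) : ℕ → Config S A → Config S A → Prop
  | 0, c, c' => c = c'
  | n + 1, c, c' => ∃ d, CanStep M L c d ∧ CanReach M L n d c'

theorem CanReach.trans {M : MDP S A} {L : Learner S A} {m n : ℕ} {c d e : Config S A}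
    (h₁ : CanReach M L m c d) (h₂ : CanReach M L n d e) : CanReach M L (m + n) c e := by
  induction m generalizing c with
  | zero =>
    cases h₁
    simpa using h₂
  | succ m ih =>
    obtain ⟨x, hx, hxd⟩ := h₁
    rw [Nat.succ_add]
    exact ⟨x, hx, ih hxd⟩

theorem CanReach.exists_seq {M : MDP S A} {L : Learner S A} {n : ℕ} {c c' : Config S A}
    (h : CanReach M L n c c') :
    ∃ f : ℕ → Config S A, f 0 = c ∧ f n = c' ∧ ∀ i < n, CanStep M L (f i) (f (i + 1)) := by
  induction n generalizing c with
  | zero => exact ⟨fun _ => c, rfl, h, by simp⟩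
  | succ n ih =>
    obtain ⟨d, hd, hdc⟩ := h
    obtain ⟨f, hf0, hfn, hf⟩ := ih hdc
    refine ⟨fun i => Nat.casesOn i c f, rfl, hfn, fun i hi => ?_⟩
    cases i with
    | zero => simpa [hf0] using hd
    | succ i => exact hf i (by omega)

open Classical in
/-- The teacher that drives the learner along the sequence `f` of configurations as far as it can,
and leaves the draws to the MDP elsewhere. -/
noncomputable def followTeacher (M : MDP S A) (f : ℕ → Config S A) : Level3Teacher M where
  init h := if 0 < M.μ₀ (f h.length).state then PMF.pure (f h.length).state else M.μ₀
  reply h s a :=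
    if hx : ∃ x : ℝ × S, 0 < M.P s a x.2 ∧ (f (h.length + 1)).past = ⟨s, a, x.1, x.2⟩ :: h then
      PMF.pure hx.choose
    else (M.P s a).map fun s' => (0, s')
  init_supported h s hs := by
    split_ifs at hs with h0
    · rw [PMF.support_pure, Set.mem_singleton_iff] at hs
      exact hs ▸ h0
    · exact pos_iff_ne_zero.2 hs
  reply_supported h s a x hx := by
    split_ifs at hx with h0
    · rw [PMF.support_pure, Set.mem_singleton_iff] at hx
      exact hx ▸ h0.choose_spec.1
    · rw [PMF.support_map] at hx
      obtain ⟨y, hy, rfl⟩ := hx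
      exact pos_iff_ne_zero.2 hy

theorem protocolStep_followTeacher [Fintype A] {M : MDP S A} {L : Learner S A} (hε : L.ε = 0)
    {π : S → A} {f : ℕ → Config S A} {n : ℕ} (hlen : (f n).past.length = n)
    (hn : ¬ Learned L π (f n)) (hf : CanStep M L (f n) (f (n + 1))) :
    protocolStep L π (followTeacher M f) (f n) = PMF.pure (f (n + 1)) := by
  obtain ⟨r, s', hP, hpast, hQ, hstate⟩ := hf
  have hex : ∃ x : ℝ × S, 0 < M.P (f n).state (L.greedy (f n).Q (f n).state) x.2 ∧
      (f ((f n).past.length + 1)).past =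
        ⟨(f n).state, L.greedy (f n).Q (f n).state, x.1, x.2⟩ :: (f n).past :=
    ⟨(r, s'), hP, by rw [hlen]; exact hpast⟩
  have hreply : (followTeacher M f).reply (f n).past (f n).state
      (L.greedy (f n).Q (f n).state) = PMF.pure (r, s') := by
    have h := ((congrArg (fun m => (f (m + 1)).past) hlen).trans hpast).symm.trans
      hex.choose_spec.2
    simp only [List.cons.injEq, Experience.mk.injEq, true_and, and_true] at h
    simp only [followTeacher]
    rw [dif_pos hex]
    congr 1
    exact Prod.ext h.1.symm h.2.symm
  rw [protocolStep, if_neg hn, L.behavior_eq_pure hε, PMF.pure_bind, hreply, PMF.pure_bind,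
    afterExperience]
  simp only [List.length_cons]
  generalize hc : f (n + 1) = c at *
  obtain ⟨p, Q, s⟩ := c
  simp only at hpast hQ hstate
  subst hpast hQ
  split_ifs at hstate ⊢ with hH
  · simp only [followTeacher, List.length_cons, hlen, hc]
    rw [if_pos hstate, PMF.pure_map]
  · rw [hstate]

/-- Teaching along a sequence of enforceable transitions takes at most its length. -/
theorem METaL_le_of_canReach [Fintype A] {M : MDP S A} {L : Learner S A} (hε : L.ε = 0)
    {π : S → A} {Q₀ : QTable S A} {s₀ : S} (hs₀ : 0 < M.μ₀ s₀) {N : ℕ} {c : Config S A}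
    (h : CanReach M L N ⟨[], Q₀, s₀⟩ c) (hc : Learned L π c) : METaL M L Q₀ π ≤ N := by
  classical
  obtain ⟨f, hf0, hfN, hf⟩ := h.exists_seq
  have hlen : ∀ i ≤ N, (f i).past.length = i := by
    intro i
    induction i with
    | zero => simp [hf0]
    | succ i ih =>
      intro hi
      obtain ⟨r, s', -, hp, -⟩ := hf i hi
      rw [hp, List.length_cons, ih (by omega)]
  have hex : ∃ n, Learned L π (f n) := ⟨N, hfN ▸ hc⟩
  have hTN : Nat.find hex ≤ N := Nat.find_min' hex (hfN ▸ hc)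
  have hlaw : ∀ i ≤ Nat.find hex, configLaw L Q₀ π (followTeacher M f) i = PMF.pure (f i) := by
    intro i
    induction i with
    | zero =>
      intro _
      simp only [configLaw, followTeacher, List.length_nil, hf0]
      rw [if_pos hs₀, PMF.pure_map]
    | succ i ih =>
      intro hi
      rw [configLaw, ih (by omega), PMF.pure_bind]
      exact protocolStep_followTeacher hε (hlen i (by omega)) (Nat.find_min hex hi)
        (hf i (by omega))
  have hend : ∀ j, configLaw L Q₀ π (followTeacher M f) (Nat.find hex + j) =
      PMF.pure (f (Nat.find hex)) := by
    intro j
    induction j with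
    | zero => exact hlaw _ le_rfl
    | succ j ih =>
      rw [← add_assoc, configLaw, ih, PMF.pure_bind, protocolStep, if_pos (Nat.find_spec hex)]
  refine (iInf_le _ (followTeacher M f)).trans ?_
  rw [expectedLength, tsum_eq_sum (s := Finset.range N)]
  · refine (Finset.sum_le_card_nsmul _ _ 1 fun n _ => ?_).trans (by simp)
    rw [PMF.toOuterMeasure_apply, ← PMF.tsum_coe (configLaw L Q₀ π (followTeacher M f) n)]
    exact ENNReal.tsum_le_tsum fun x => Set.indicator_le_self _ _ _
  · intro n hn
    rw [Finset.mem_range, not_lt] at hn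
    obtain ⟨j, rfl⟩ := Nat.exists_eq_add_of_le (hTN.trans hn)
    rw [hend, PMF.toOuterMeasure_pure_apply, if_neg]
    simpa using Nat.find_spec hex

/-! ### The potential of a Q-table -/

/-- The target action is strictly first at `s`. -/
def Good (π : S → A) (Q : QTable S A) (s : S) : Prop :=
  ∀ b, b ≠ π s → Q s b < Q s (π s)

/-- All states that can be reached from `s` along the navigation edges `child p a c` (from `p` with
the action `a` to `c`), including `s` itself, have their target action strictly first. -/
def Taught (child : S → A → S → Prop) (π : S → A) (Q : QTable S A) (s : S) : Prop :=
  ∀ x, Relation.ReflTransGen (fun p c => ∃ a, child p a c) s x → Good π Q x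

/-- The actions at `s` still needed to navigate to a child that has not been taught. -/
def pending (child : S → A → S → Prop) (π : S → A) (Q : QTable S A) (s : S) : Set A :=
  {a | ∃ c, child s a c ∧ ¬ Taught child π Q c}

open Classical in
/-- A bound on the number of changes of the ranking at `s` still required. While some action is pending, only
actions ranked at least as high as a pending one may have to be demoted before the last pending
action has been used; the summand `|A|` pays for teaching `π s` afterwards. -/
noncomputable def potential [Fintype A] (child : S → A → S → Prop) (π : S → A) (Q : QTable S A)
    (s : S) : ℕ :=
  if pending child π Q s = ∅ then {b | b ≠ π s ∧ Q s (π s) ≤ Q s b}.ncard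
  else Fintype.card A + {b | ∃ u ∈ pending child π Q s, Q s u ≤ Q s b}.ncard

/-- Two Q-tables rank the actions at every state in the same way. -/
def SameOrder (Q Q' : QTable S A) : Prop :=
  ∀ s a b, Q' s a < Q' s b ↔ Q s a < Q s b

theorem Taught.of_child {child : S → A → S → Prop} {π : S → A} {Q : QTable S A} {p c : S} {a : A}
    (h : Taught child π Q p) (hc : child p a c) : Taught child π Q c :=
  fun x hx => h x (.head ⟨a, hc⟩ hx)

theorem good_of_ne {π : S → A} {Q Q' : QTable S A} {s : S} (h : ∀ b, Q' s b = Q s b)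
    (hg : Good π Q s) : Good π Q' s := by
  intro b hb
  rw [h, h]
  exact hg b hb

theorem SameOrder.taught_iff {child : S → A → S → Prop} {π : S → A} {Q Q' : QTable S A}
    (h : SameOrder Q Q') (s : S) : Taught child π Q' s ↔ Taught child π Q s := by
  simp only [Taught, Good, h _ _ _]

theorem SameOrder.potential_eq [Fintype A] {child : S → A → S → Prop} {π : S → A}
    {Q Q' : QTable S A} (h : SameOrder Q Q') (s : S) :
    potential child π Q' s = potential child π Q s := by
  have hle : ∀ a b, Q' s a ≤ Q' s b ↔ Q s a ≤ Q s b := fun a b => by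
    rw [← not_lt, ← not_lt, h]
  have hp : pending child π Q' s = pending child π Q s := by
    simp only [pending, h.taught_iff]
  rw [potential, potential, hp]
  simp only [hle]

theorem SameOrder.trans {Q Q' Q'' : QTable S A} (h : SameOrder Q Q') (h' : SameOrder Q' Q'') :
    SameOrder Q Q'' :=
  fun s a b => (h' s a b).trans (h s a b)

theorem potential_le [Fintype A] (child : S → A → S → Prop) (π : S → A) (Q : QTable S A)
    (s : S) : potential child π Q s ≤ 2 * Fintype.card A := by
  have h : ∀ X : Set A, X.ncard ≤ Fintype.card A := fun X =>
    (Set.ncard_le_card X).trans_eq Nat.card_eq_fintype_card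
  rw [potential]
  split_ifs
  · exact (h _).trans (by omega)
  · have := h {b | ∃ u ∈ pending child π Q s, Q s u ≤ Q s b}
    omega

theorem potential_le_of_pending_subset [Fintype A] {child : S → A → S → Prop} {π : S → A}
    {Q Q' : QTable S A} {s : S} (h : ∀ b, Q' s b = Q s b)
    (hp : pending child π Q' s ⊆ pending child π Q s) :
    potential child π Q' s ≤ potential child π Q s := by
  rw [potential, potential]
  simp only [h]
  split_ifs with h1 h2 h2
  · exact le_rfl
  · exact ((Set.ncard_le_card _).trans_eq Nat.card_eq_fintype_card).trans (Nat.le_add_right _ _)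
  · exact absurd (Set.subset_eq_empty hp h2) h1
  · refine Nat.add_le_add_left (Set.ncard_le_ncard ?_) _
    rintro b ⟨u, hu, hub⟩
    exact ⟨u, hp hu, hub⟩

theorem taught_iff_good {child : S → A → S → Prop} {π : S → A} {Q : QTable S A} {s : S}
    (h : pending child π Q s = ∅) : Taught child π Q s ↔ Good π Q s := by
  refine ⟨fun ht => ht s .refl, fun hg x hx => ?_⟩
  rcases hx.cases_head with rfl | ⟨c, ⟨a, hc⟩, hcx⟩
  · exact hg
  · by_contra hx
    exact Set.eq_empty_iff_forall_notMem.1 h a ⟨c, hc, fun ht => hx (ht x hcx)⟩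

/-- Demoting the greedy action, unless it is pending, lowers the potential of its state; so does
promoting the target action if it is greedy and nothing is pending. The potentials of the other
states do not grow, as a taught state remains taught. -/
theorem exists_reward_potential_lt [Fintype S] [Fintype A] (L : Learner S A)
    {child : S → A → S → Prop} {π : S → A} {Q : QTable S A} {s : S}
    (hs : ¬ Taught child π Q s) (ha : L.greedy Q s ∉ pending child π Q s) (s' : S) :
    ∃ r : ℝ, ∑ x, potential child π (L.update Q ⟨s, L.greedy Q s, r, s'⟩) x <
      ∑ x, potential child π Q x := by
  set a := L.greedy Q s with hadef
  have hmax : ∀ b, Q s b ≤ Q s a := L.le_greedy Q s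
  have hother : ∀ r x, x ≠ s → ∀ b, L.update Q ⟨s, a, r, s'⟩ x b = Q x b := fun r x hx b =>
    L.update_of_ne _ _ _ _ fun h => hx h.1
  have hact : ∀ r b, b ≠ a → L.update Q ⟨s, a, r, s'⟩ s b = Q s b := fun r b hb =>
    L.update_of_ne _ _ _ _ fun h => hb h.2
  have htaught : ∀ r x, Taught child π Q x → Taught child π (L.update Q ⟨s, a, r, s'⟩) x := by
    intro r x hx y hy
    refine good_of_ne (hother r y ?_) (hx y hy)
    rintro rfl
    exact hs fun z hz => hx z (hy.trans hz)
  have hpend : ∀ r x, pending child π (L.update Q ⟨s, a, r, s'⟩) x ⊆ pending child π Q x :=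
    fun r x b ⟨c, hc, hn⟩ => ⟨c, hc, fun ht => hn (htaught r c ht)⟩
  suffices h : ∃ r, potential child π (L.update Q ⟨s, a, r, s'⟩) s < potential child π Q s by
    obtain ⟨r, hr⟩ := h
    refine ⟨r, Finset.sum_lt_sum (fun x _ => ?_) ⟨s, Finset.mem_univ s, hr⟩⟩
    by_cases hx : x = s
    · exact hx ▸ hr.le
    · exact potential_le_of_pending_subset (hother r x hx) (hpend r x)
  by_cases hp : pending child π Q s = ∅
  · by_cases haπ : a = π s
    · obtain ⟨r, hr⟩ := L.exists_first Q s a s'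
      refine ⟨r, ?_⟩
      have hp' := Set.subset_eq_empty (hpend r s) hp
      rw [potential, potential, if_pos hp', if_pos hp]
      rw [taught_iff_good hp, Good] at hs
      push Not at hs
      obtain ⟨b, hb, hbπ⟩ := hs
      refine lt_of_eq_of_lt (b := 0) ?_ ((Set.ncard_pos).2 ⟨b, hb, hbπ⟩)
      rw [Set.ncard_eq_zero, Set.eq_empty_iff_forall_notMem]
      rintro d ⟨hd, hd'⟩
      rw [← haπ] at hd hd'
      exact (hr d hd).not_ge hd'
    · obtain ⟨r, hr⟩ := L.exists_last Q s a s'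
      refine ⟨r, ?_⟩
      have hp' := Set.subset_eq_empty (hpend r s) hp
      rw [potential, potential, if_pos hp', if_pos hp]
      refine Set.ncard_lt_ncard ⟨fun b ⟨hb, hb'⟩ => ⟨hb, ?_⟩, fun hsub => ?_⟩
      · have hba : b ≠ a := by
          rintro rfl
          exact (hr _ (Ne.symm haπ)).not_ge hb'
        rwa [hact r b hba, hact r _ (Ne.symm haπ)] at hb'
      · exact (hr _ (Ne.symm haπ)).not_ge (hsub ⟨haπ, hmax _⟩).2
  · obtain ⟨r, hr⟩ := L.exists_last Q s a s'
    refine ⟨r, ?_⟩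
    obtain ⟨u, hu⟩ := Set.nonempty_iff_ne_empty.2 hp
    have hua : ∀ v ∈ pending child π Q s, v ≠ a := fun v hv h => ha (h ▸ hv)
    have hlt : {b | ∃ u ∈ pending child π (L.update Q ⟨s, a, r, s'⟩) s,
        L.update Q ⟨s, a, r, s'⟩ s u ≤ L.update Q ⟨s, a, r, s'⟩ s b}.ncard <
        {b | ∃ u ∈ pending child π Q s, Q s u ≤ Q s b}.ncard := by
      refine Set.ncard_lt_ncard ⟨?_, fun hsub => ?_⟩
      · rintro b ⟨v, hv, hvb⟩
        have hva := hua v (hpend r s hv)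
        have hba : b ≠ a := by
          rintro rfl
          exact (hr v hva).not_ge hvb
        rw [hact r b hba, hact r v hva] at hvb
        exact ⟨v, hpend r s hv, hvb⟩
      · obtain ⟨v, hv, hva⟩ := hsub (show a ∈ _ from ⟨u, hu, hmax u⟩)
        exact (hr v (hua v (hpend r s hv))).not_ge hva
    rw [potential, potential, if_neg hp]
    split_ifs
    · refine lt_of_le_of_lt ?_ (Nat.lt_add_of_pos_right (Nat.zero_lt_of_lt hlt))
      exact (Set.ncard_le_card _).trans_eq Nat.card_eq_fintype_card
    · exact Nat.add_lt_add_left hlt _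

/-! ### The upper bound -/

theorem exists_reward_sameOrder (L : Learner S A) (Q : QTable S A) (s : S) (a : A) (s' : S) :
    ∃ r : ℝ, SameOrder Q (L.update Q ⟨s, a, r, s'⟩) := by
  obtain ⟨r, hr⟩ := L.exists_unchanged Q s a s'
  refine ⟨r, fun x b d => ?_⟩
  have hne : ∀ d, ¬ (x = s ∧ d = a) → L.update Q ⟨s, a, r, s'⟩ x d = Q x d :=
    fun d h => L.update_of_ne _ _ _ _ h
  by_cases hb : x = s ∧ b = a
  · obtain ⟨rfl, rfl⟩ := hb
    exact (hr d).2
  · by_cases hd : x = s ∧ d = a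
    · obtain ⟨rfl, rfl⟩ := hd
      exact (hr b).1
    · rw [hne b hb, hne d hd]

/-- From `c`, the current episode can be completed in `n` time steps so as to end with a Q-table
that satisfies `p`; the next initial state is still free. -/
def CanFinishEpisode (M : MDP S A) (L : Learner S A) (n : ℕ) (c : Config S A)
    (p : QTable S A → Prop) : Prop :=
  ∃ past' Q', p Q' ∧ past'.length = c.past.length + n ∧
    ∀ s₀, 0 < M.μ₀ s₀ → CanReach M L n c ⟨past', Q', s₀⟩

theorem CanFinishEpisode.of_last_step {M : MDP S A} {L : Learner S A} {c : Config S A}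
    {p : QTable S A → Prop} {r : ℝ} {s' : S}
    (hP : 0 < M.P c.state (L.greedy c.Q c.state) s') (hH : M.H ∣ c.past.length + 1)
    (hp : p (L.update c.Q ⟨c.state, L.greedy c.Q c.state, r, s'⟩)) :
    CanFinishEpisode M L 1 c p :=
  ⟨_, _, hp, rfl, fun s₀ hs₀ => ⟨_, ⟨r, s', hP, rfl, rfl, by rwa [if_pos hH]⟩, rfl⟩⟩

theorem CanFinishEpisode.step {M : MDP S A} {L : Learner S A} {n : ℕ} {c : Config S A}
    {p : QTable S A → Prop} {r : ℝ} {s' : S}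
    (hP : 0 < M.P c.state (L.greedy c.Q c.state) s') (hH : ¬ M.H ∣ c.past.length + 1)
    (h : CanFinishEpisode M L n ⟨⟨c.state, L.greedy c.Q c.state, r, s'⟩ :: c.past,
      L.update c.Q ⟨c.state, L.greedy c.Q c.state, r, s'⟩, s'⟩ p) :
    CanFinishEpisode M L (n + 1) c p := by
  obtain ⟨past', Q', hp, hlen, hreach⟩ := h
  refine ⟨past', Q', hp, by simp only [List.length_cons] at hlen; omega, fun s₀ hs₀ => ?_⟩
  exact ⟨_, ⟨r, s', hP, rfl, rfl, by rw [if_neg hH]⟩, hreach s₀ hs₀⟩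

theorem CanFinishEpisode.mono {M : MDP S A} {L : Learner S A} {n : ℕ} {c : Config S A}
    {p q : QTable S A → Prop} (h : CanFinishEpisode M L n c p) (hpq : ∀ Q, p Q → q Q) :
    CanFinishEpisode M L n c q := by
  obtain ⟨past', Q', hp, h⟩ := h
  exact ⟨past', Q', hpq _ hp, h⟩

theorem exists_pos (p : PMF S) : ∃ s, 0 < p s := by
  obtain ⟨s, hs⟩ := p.support_nonempty
  exact ⟨s, pos_iff_ne_zero.2 hs⟩

theorem not_dvd_of_mod_add {n k H : ℕ} (h : n % H + (k + 1) + 1 = H) : ¬ H ∣ n + 1 := by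
  rw [Nat.dvd_iff_mod_eq_zero, Nat.add_mod, Nat.mod_eq_of_lt (a := 1) (by omega),
    Nat.mod_eq_of_lt (by omega)]
  omega

theorem succ_mod_of_mod_add {n k H : ℕ} (h : n % H + (k + 1) + 1 = H) :
    (n + 1) % H = n % H + 1 := by
  rw [Nat.add_mod, Nat.mod_eq_of_lt (a := 1) (by omega), Nat.mod_eq_of_lt (by omega)]

theorem dvd_of_mod_add {n H : ℕ} (h : n % H + 1 = H) : H ∣ n + 1 := by
  rw [Nat.dvd_iff_mod_eq_zero, ← Nat.mod_add_mod, h, Nat.mod_self]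

theorem canFinishEpisode_sameOrder (M : MDP S A) (L : Learner S A) (n : ℕ) (c : Config S A)
    (hn : c.past.length % M.H + n + 1 = M.H) :
    CanFinishEpisode M L (n + 1) c (SameOrder c.Q) := by
  induction n generalizing c with
  | zero =>
    obtain ⟨s', hs'⟩ := exists_pos (M.P c.state (L.greedy c.Q c.state))
    obtain ⟨r, hr⟩ := exists_reward_sameOrder L c.Q c.state (L.greedy c.Q c.state) s'
    exact .of_last_step hs' (dvd_of_mod_add hn) hr
  | succ n ih =>
    obtain ⟨s', hs'⟩ := exists_pos (M.P c.state (L.greedy c.Q c.state))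
    obtain ⟨r, hr⟩ := exists_reward_sameOrder L c.Q c.state (L.greedy c.Q c.state) s'
    refine .step hs' (not_dvd_of_mod_add hn) ((ih _ ?_).mono fun Q' h => hr.trans h)
    rw [List.length_cons, succ_mod_of_mod_add hn]
    omega

/-- After one update with an arbitrary reward, the rest of the episode need not change any
ranking. -/
theorem canFinishEpisode_update {M : MDP S A} {L : Learner S A} {n : ℕ} {c : Config S A}
    (hn : c.past.length % M.H + n + 1 = M.H) {r : ℝ} {s' : S}
    (hP : 0 < M.P c.state (L.greedy c.Q c.state) s') :
    CanFinishEpisode M L (n + 1) c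
      (SameOrder (L.update c.Q ⟨c.state, L.greedy c.Q c.state, r, s'⟩)) := by
  cases n with
  | zero => exact .of_last_step (r := r) hP (dvd_of_mod_add hn) fun _ _ _ => Iff.rfl
  | succ n =>
    refine .step (r := r) hP (not_dvd_of_mod_add hn) (canFinishEpisode_sameOrder M L n _ ?_)
    rw [List.length_cons, succ_mod_of_mod_add hn]
    omega

/-- The navigation edges: transitions to the next layer of a layering of the states. -/
def layerChild (M : MDP S A) (depth : S → ℕ) (p : S) (a : A) (c : S) : Prop :=
  depth c = depth p + 1 ∧ 0 < M.P p a c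

/-- One episode that starts in an untaught state can lower the total potential: the learner is led
to untaught children as long as its greedy action is pending, which stops before the episode ends
since there are at most `H` layers. -/
theorem canFinishEpisode_potential_lt [Fintype S] [Fintype A] {M : MDP S A} {L : Learner S A}
    {π : S → A} {depth : S → ℕ} (hdepth : ∀ s, depth s < M.H) (n : ℕ) (c : Config S A)
    (hn : c.past.length % M.H + n + 1 = M.H) (hc : c.past.length % M.H = depth c.state)
    (hs : ¬ Taught (layerChild M depth) π c.Q c.state) :
    CanFinishEpisode M L (n + 1) c fun Q' =>
      ∑ x, potential (layerChild M depth) π Q' x <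
        ∑ x, potential (layerChild M depth) π c.Q x := by
  induction n generalizing c with
  | zero =>
    obtain ⟨s', hs'⟩ := exists_pos (M.P c.state (L.greedy c.Q c.state))
    have ha : L.greedy c.Q c.state ∉ pending (layerChild M depth) π c.Q c.state := by
      rintro ⟨d, ⟨hd, -⟩, -⟩
      have := hdepth d
      omega
    obtain ⟨r, hr⟩ := exists_reward_potential_lt L hs ha s'
    exact .of_last_step hs' (dvd_of_mod_add hn) hr
  | succ n ih =>
    by_cases ha : L.greedy c.Q c.state ∈ pending (layerChild M depth) π c.Q c.state
    · obtain ⟨d, ⟨hd, hP⟩, hdt⟩ := ha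
      obtain ⟨r, hr⟩ := exists_reward_sameOrder L c.Q c.state (L.greedy c.Q c.state) d
      refine .step (r := r) hP (not_dvd_of_mod_add hn) ((ih _ ?_ ?_ ?_).mono fun Q' h => ?_)
      · rw [List.length_cons, succ_mod_of_mod_add hn]
        omega
      · rw [List.length_cons, succ_mod_of_mod_add hn, hc, hd]
      · rwa [hr.taught_iff]
      · simpa only [hr.potential_eq] using h
    · obtain ⟨s', hs'⟩ := exists_pos (M.P c.state (L.greedy c.Q c.state))
      obtain ⟨r, hr⟩ := exists_reward_potential_lt L hs ha s'
      refine (canFinishEpisode_update (r := r) hn hs').mono fun Q' h => ?_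
      simpa only [h.potential_eq] using hr

theorem exists_layering {M : MDP S A} {D : ℕ} (hD : M.diameter = D) :
    ∃ depth : S → ℕ, (∀ s, depth s ≤ D) ∧ (∀ s, depth s = 0 ↔ 0 < M.μ₀ s) ∧
      ∀ s k, depth s = k + 1 → ∃ p a, depth p = k ∧ 0 < M.P p a s := by
  classical
  have hex : ∀ s, ∃ n ≤ D, M.Reach n s := by
    intro s
    have h : ⨅ (n : ℕ) (_ : M.Reach n s), (n : ℕ∞) ≤ (D : ℕ∞) :=
      hD ▸ le_iSup (fun s : S => ⨅ (n : ℕ) (_ : M.Reach n s), (n : ℕ∞)) s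
    by_contra! hcon
    have h' : ((D + 1 : ℕ) : ℕ∞) ≤ ⨅ (n : ℕ) (_ : M.Reach n s), (n : ℕ∞) := by
      refine le_iInf₂ fun n hn => ?_
      by_contra hlt
      rw [not_le, Nat.cast_lt] at hlt
      exact hcon n (by omega) hn
    have := h'.trans h
    rw [Nat.cast_le] at this
    omega
  have hex' : ∀ s, ∃ n, M.Reach n s := fun s => (hex s).imp fun _ h => h.2
  refine ⟨fun s => Nat.find (hex' s), fun s => ?_, fun s => ?_, fun s k hk => ?_⟩
  · obtain ⟨n, hn, hr⟩ := hex s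
    exact (Nat.find_min' (hex' s) hr).trans hn
  · rw [Nat.find_eq_zero]
    rfl
  · have hr := Nat.find_spec (hex' s)
    rw [show Nat.find (hex' s) = k + 1 from hk] at hr
    obtain ⟨p, a, hp, hP⟩ := hr
    refine ⟨p, a, le_antisymm (Nat.find_min' (hex' p) hp) ?_, hP⟩
    beta_reduce at hk ⊢
    have : Nat.find (hex' s) ≤ Nat.find (hex' p) + 1 :=
      Nat.find_min' (hex' s) ⟨p, a, Nat.find_spec (hex' p), hP⟩
    omega

theorem Learner.greedy_eq_of_good {L : Learner S A} {π : S → A} {Q : QTable S A}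
    (h : ∀ s, Good π Q s) : L.greedy Q = π := by
  funext s
  by_contra hne
  exact (h s _ hne).not_ge (L.le_greedy Q s (π s))

theorem METaL_le [Fintype S] [Fintype A] {M : MDP S A} {L : Learner S A} (hε : L.ε = 0) {D : ℕ}
    (hD : M.diameter = D) (hDH : D < M.H) (Q₀ : QTable S A) (π : S → A) :
    METaL M L Q₀ π ≤ 2 * (Fintype.card S * Fintype.card A * M.H) := by
  obtain ⟨depth, hle, hzero, hsucc⟩ := exists_layering hD
  have hroot : ∀ Q k x, depth x = k → ¬ Taught (layerChild M depth) π Q x →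
      ∃ s₀, depth s₀ = 0 ∧ ¬ Taught (layerChild M depth) π Q s₀ := by
    intro Q k
    induction k with
    | zero => exact fun x hx hn => ⟨x, hx, hn⟩
    | succ k ih =>
      intro x hx hn
      obtain ⟨p, a, hp, hP⟩ := hsucc x k hx
      exact ih p hp fun ht => hn (ht.of_child (a := a) ⟨by omega, hP⟩)
  have key : ∀ φ past Q, M.H ∣ past.length →
      ∑ x, potential (layerChild M depth) π Q x ≤ φ →
      ∃ s₀, 0 < M.μ₀ s₀ ∧ ∃ N ≤ φ * M.H, ∃ c, CanReach M L N ⟨past, Q, s₀⟩ c ∧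
        Learned L π c := by
    intro φ
    induction φ using Nat.strong_induction_on with
    | _ φ ih =>
      intro past Q hH hφ
      by_cases hall : ∀ x, Taught (layerChild M depth) π Q x
      · obtain ⟨s₀, hs₀⟩ := exists_pos M.μ₀
        exact ⟨s₀, hs₀, 0, Nat.zero_le _, _, rfl,
          Learner.greedy_eq_of_good fun x => hall x x .refl⟩
      · push Not at hall
        obtain ⟨x, hx⟩ := hall
        obtain ⟨s₀, hs₀, hnt⟩ := hroot Q _ x rfl hx
        have hmod : past.length % M.H = 0 := Nat.mod_eq_zero_of_dvd hH
        obtain ⟨past', Q', hlt, hlen, hreach⟩ :=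
          canFinishEpisode_potential_lt (fun s => (hle s).trans_lt hDH) (M.H - 1) ⟨past, Q, s₀⟩
            (by simp only; omega) (by simp only; omega) hnt
        rw [Nat.sub_add_cancel (by omega)] at hlen hreach
        obtain ⟨s₁, hs₁, N, hN, c, hc, hL⟩ := ih _ (hlt.trans_le hφ) past' Q'
          (by rw [hlen]; exact (Nat.dvd_add_left dvd_rfl).2 hH) le_rfl
        refine ⟨s₀, (hzero s₀).1 hs₀, M.H + N, ?_, c, (hreach s₁ hs₁).trans hc, hL⟩
        calc M.H + N ≤ (∑ x, potential (layerChild M depth) π Q' x + 1) * M.H := by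
              rw [add_mul, one_mul, add_comm]
              exact Nat.add_le_add_right hN _
          _ ≤ φ * M.H := Nat.mul_le_mul_right _ (hlt.trans_le hφ)
  obtain ⟨s₀, hs₀, N, hN, c, hc, hL⟩ :=
    key (Fintype.card S * (2 * Fintype.card A)) [] Q₀ (dvd_zero _)
      ((Finset.sum_le_card_nsmul _ _ _ fun x _ => potential_le _ π Q₀ x).trans_eq rfl)
  refine (METaL_le_of_canReach hε hs₀ hc hL).trans ?_
  have : (N : ℝ≥0∞) ≤ (Fintype.card S * (2 * Fintype.card A) * M.H : ℕ) := by exact_mod_cast hN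
  refine this.trans_eq ?_
  push_cast
  ring

/-! ### The lower bound -/

/-- If `W` is a measure of the remaining work that no transition lowers, except that the start of an
episode may lower it by one, then teaching takes almost one episode for each unit of `W`. -/
theorem le_METaL [Fintype A] {M : MDP S A} {L : Learner S A} (hε : L.ε = 0) {π : S → A}
    {Q₀ : QTable S A} (W : QTable S A → S → ℕ) {K : ℕ}
    (hstep : ∀ Q s r s', 0 < M.P s (L.greedy Q s) s' →
      W Q s ≤ W (L.update Q ⟨s, L.greedy Q s, r, s'⟩) s')
    (hmove : ∀ Q s s', W Q s ≤ W Q s' + 1) (hinit : ∀ s, K + 1 ≤ W Q₀ s)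
    (hlearned : ∀ Q s, L.greedy Q = π → W Q s ≤ 1) :
    (K * M.H : ℕ) ≤ METaL M L Q₀ π := by
  refine le_iInf fun τ => ?_
  have hinv : ∀ n, ∀ c ∈ (configLaw L Q₀ π τ n).support,
      c.past.length ≤ n ∧ K + 1 ≤ W c.Q c.state + c.past.length / M.H := by
    intro n
    induction n with
    | zero =>
      intro c hc
      rw [configLaw, PMF.support_map] at hc
      obtain ⟨s, -, rfl⟩ := hc
      exact ⟨le_rfl, (hinit s).trans (Nat.le_add_right _ _)⟩
    | succ n ih =>
      intro c hc
      rw [configLaw, PMF.mem_support_bind_iff] at hc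
      obtain ⟨d, hd, hc⟩ := hc
      obtain ⟨hlen, hK⟩ := ih d hd
      rw [protocolStep] at hc
      split_ifs at hc with hL
      · rw [PMF.support_pure, Set.mem_singleton_iff] at hc
        exact hc ▸ ⟨hlen.trans (Nat.le_succ n), hK⟩
      · rw [L.behavior_eq_pure hε, PMF.pure_bind, PMF.mem_support_bind_iff] at hc
        obtain ⟨⟨r, s'⟩, hx, hc⟩ := hc
        have hW := hstep d.Q d.state r s' (τ.reply_supported _ _ _ _ hx)
        rw [afterExperience] at hc
        split_ifs at hc with hH
        · rw [PMF.support_map] at hc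
          obtain ⟨s, -, rfl⟩ := hc
          refine ⟨by simpa using hlen, ?_⟩
          have hm := hmove (L.update d.Q ⟨d.state, L.greedy d.Q d.state, r, s'⟩) s' s
          rw [List.length_cons] at hH ⊢
          rw [Nat.succ_div_of_dvd hH]
          simp only
          omega
        · rw [PMF.support_pure, Set.mem_singleton_iff] at hc
          subst hc
          refine ⟨by simpa using hlen, hK.trans (Nat.add_le_add hW ?_)⟩
          exact Nat.div_le_div_right (Nat.le_succ _)
  calc ((K * M.H : ℕ) : ℝ≥0∞) = ∑ n ∈ Finset.range (K * M.H), 1 := by simp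
    _ ≤ ∑ n ∈ Finset.range (K * M.H),
        (configLaw L Q₀ π τ n).toOuterMeasure {c | ¬ Learned L π c} := by
      refine Finset.sum_le_sum fun n hn => ?_
      rw [Finset.mem_range] at hn
      refine ((PMF.toOuterMeasure_apply_eq_one_iff _ _).2 fun c hc hL => ?_).ge
      obtain ⟨hlen, hK⟩ := hinv n c hc
      have h1 := hlearned c.Q c.state hL
      have h2 : c.past.length / M.H < K :=
        Nat.div_lt_of_lt_mul (hlen.trans_lt (by rwa [mul_comm] at hn))
      omega
    _ ≤ expectedLength L Q₀ π τ := ENNReal.sum_le_tsum _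

/-- The number of actions at `s` that are ranked strictly above `a`. -/
noncomputable def numAbove (a : A) (Q : QTable S A) (s : S) : ℕ :=
  {b | Q s a < Q s b}.ncard

theorem numAbove_update_of_ne (L : Learner S A) (a : A) (Q : QTable S A) {e : Experience S A}
    {s : S} (hs : s ≠ e.state) : numAbove a (L.update Q e) s = numAbove a Q s := by
  have h : ∀ b, L.update Q e s b = Q s b := fun b => L.update_of_ne _ _ _ _ fun h => hs h.1
  simp only [numAbove, h]

theorem numAbove_greedy (L : Learner S A) (Q : QTable S A) (s : S) :
    numAbove (L.greedy Q s) Q s = 0 := by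
  have h : {b | Q s (L.greedy Q s) < Q s b} = ∅ :=
    Set.eq_empty_iff_forall_notMem.2 fun b hb => hb.not_ge (L.le_greedy Q s b)
  rw [numAbove, h, Set.ncard_empty]

theorem numAbove_le_update_add_one [Fintype A] (L : Learner S A) {a : A} (Q : QTable S A)
    {e : Experience S A} (ha : a ≠ e.action) (s : S) :
    numAbove a Q s ≤ numAbove a (L.update Q e) s + 1 := by
  have h : ∀ b, b ≠ e.action → L.update Q e s b = Q s b :=
    fun b hb => L.update_of_ne _ _ _ _ fun h => hb h.2
  refine le_trans (Set.ncard_le_ncard fun b hb => ?_) (Set.ncard_insert_le e.action _)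
  by_cases hb' : b = e.action
  · exact .inl hb'
  · refine .inr ?_
    rw [Set.mem_ofPred_eq, h a ha, h b hb']
    exact hb

open Classical in
/-- The Q-table that ranks `a` strictly last and the other actions equally at every state. -/
noncomputable def worstTable (S : Type*) {A : Type*} (a : A) : QTable S A :=
  fun _ b => if b = a then 0 else 1

theorem numAbove_worstTable [Fintype A] (a : A) (s : S) :
    numAbove a (worstTable S a) s = Fintype.card A - 1 := by
  have h : {b | worstTable S a s a < worstTable S a s b} = {a}ᶜ := by
    ext b
    by_cases hb : b = a <;> simp [worstTable, hb]
  rw [numAbove, h, Set.ncard_compl, Set.ncard_singleton, Nat.card_eq_fintype_card]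

/-- The MDP in which all states are absorbing and initial. -/
noncomputable def absorbingMDP (S A : Type*) [Fintype S] [Nonempty S] (H : ℕ) : MDP S A where
  R _ _ := 0
  P s _ := PMF.pure s
  μ₀ := PMF.uniformOfFintype S
  H := H

theorem absorbingMDP_diameter [Fintype S] [Nonempty S] (H : ℕ) :
    (absorbingMDP S A H).diameter = 0 := by
  rw [← nonpos_iff_eq_zero]
  exact iSup_le fun s => iInf₂_le_of_le 0
    (pos_iff_ne_zero.2 (PMF.mem_support_uniformOfFintype s)) (by simp)

/-- In an episode only one of the absorbing states can be taught. -/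
theorem le_METaL_absorbingMDP [Fintype S] [Nonempty S] [Fintype A] (hA : 2 ≤ Fintype.card A)
    {L : Learner S A} (hε : L.ε = 0) (H : ℕ) (a : A) :
    ((Fintype.card S - 1) * H : ℕ) ≤
      METaL (absorbingMDP S A H) L (worstTable S a) fun _ => a := by
  refine le_METaL hε (fun Q s => {x | x ≠ s ∧ numAbove a Q x ≠ 0}.ncard + 1) ?_ ?_ ?_ ?_
  · intro Q s r s' hP
    have hs : s' = s := by
      by_contra hne
      simp [absorbingMDP, PMF.pure_apply, hne] at hP
    subst hs
    refine Nat.add_le_add_right (Set.ncard_le_ncard ?_) 1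
    intro x hx
    refine ⟨hx.1, ?_⟩
    rw [numAbove_update_of_ne L a Q hx.1]
    exact hx.2
  · intro Q s s'
    refine Nat.add_le_add_right (le_trans (Set.ncard_le_ncard fun x hx => ?_)
      (Set.ncard_insert_le s' _)) 1
    by_cases hx' : x = s'
    · exact .inl hx'
    · exact .inr ⟨hx', hx.2⟩
  · intro s
    have h : {x | x ≠ s ∧ numAbove a (worstTable S a) x ≠ 0} = {s}ᶜ := by
      ext x
      have : Fintype.card A - 1 ≠ 0 := by omega
      simp [numAbove_worstTable, this]
    rw [h, Set.ncard_compl, Set.ncard_singleton, Nat.card_eq_fintype_card]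
  · intro Q s hL
    have h : ∀ x, numAbove a Q x = 0 := fun x => by
      have := numAbove_greedy L Q x
      rwa [hL] at this
    simp [h]

/-- A chain `0 → 1 → ⋯ → D` along the action `a`, with a sink as the last state; `idx` numbers the
states. All other transitions lead to the sink, and the initial states are those outside
`1, …, D`. The condition `idx s < n` only serves to make the successor an index; it holds whenever
`idx s < D` if `D < n`. -/
noncomputable def chainMDP [Fintype S] [DecidableEq A] {n : ℕ} (idx : S ≃ Fin (n + 1))
    (a : A) (H D : ℕ) : MDP S A where
  R _ _ := 0
  P s b := PMF.pure (idx.symm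
    (if h : b = a ∧ (idx s : ℕ) < D ∧ (idx s : ℕ) < n then ⟨idx s + 1, Nat.succ_lt_succ h.2.2⟩
      else Fin.last n))
  μ₀ := PMF.uniformOfFinset {s | (idx s : ℕ) = 0 ∨ D < idx s}
    (show Finset.Nonempty _ from ⟨idx.symm 0, by simp⟩)
  H := H

theorem chainMDP_μ₀_pos [Fintype S] [DecidableEq A] {n : ℕ} (idx : S ≃ Fin (n + 1)) (a : A)
    (H D : ℕ) (s : S) : 0 < (chainMDP idx a H D).μ₀ s ↔ (idx s : ℕ) = 0 ∨ D < idx s := by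
  rw [pos_iff_ne_zero, ← PMF.mem_support_iff, chainMDP, PMF.mem_support_uniformOfFinset_iff]
  simp

theorem chainMDP_P_pos [Fintype S] [DecidableEq A] {n : ℕ} (idx : S ≃ Fin (n + 1)) (a : A)
    (H : ℕ) {D : ℕ} (hD : D < n) (s : S) (b : A) (s' : S) :
    0 < (chainMDP idx a H D).P s b s' ↔
      (idx s' : ℕ) = if b = a ∧ (idx s : ℕ) < D then (idx s : ℕ) + 1 else n := by
  rw [pos_iff_ne_zero, ← PMF.mem_support_iff, chainMDP, PMF.mem_support_pure_iff,
    Equiv.eq_symm_apply, Fin.ext_iff]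
  by_cases h : b = a ∧ (idx s : ℕ) < D
  · rw [dif_pos ⟨h.1, h.2, h.2.trans hD⟩, if_pos h]
  · rw [dif_neg fun h' => h ⟨h'.1, h'.2.1⟩, if_neg h, Fin.val_last]

theorem chainMDP_diameter [Fintype S] [DecidableEq A] {n : ℕ} (idx : S ≃ Fin (n + 1)) (a : A)
    (H : ℕ) {D : ℕ} (hD : D < n) : (chainMDP idx a H D).diameter = D := by
  have hreach : ∀ k ≤ D, ∀ s, (idx s : ℕ) = k → (chainMDP idx a H D).Reach k s := by
    intro k
    induction k with
    | zero => exact fun _ s hs => (chainMDP_μ₀_pos idx a H D s).2 (.inl hs)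
    | succ k ih =>
      intro hk s hs
      have hp : (idx (idx.symm ⟨k, by omega⟩) : ℕ) = k := by simp
      refine ⟨_, a, ih (by omega) _ hp, (chainMDP_P_pos idx a H hD _ _ _).2 ?_⟩
      rw [hp, if_pos ⟨rfl, by omega⟩, hs]
  have hle : ∀ k s, (chainMDP idx a H D).Reach k s → (idx s : ℕ) ≤ k ∨ D < idx s := by
    intro k
    induction k with
    | zero =>
      intro s hs
      exact ((chainMDP_μ₀_pos idx a H D s).1 hs).imp Nat.le_of_eq id
    | succ k ih =>
      rintro s ⟨p, b, hp, hP⟩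
      rw [chainMDP_P_pos idx a H hD] at hP
      have := ih p hp
      split_ifs at hP <;> omega
  refine le_antisymm (iSup_le fun s => ?_) ?_
  · by_cases hs : (idx s : ℕ) ≤ D
    · exact iInf₂_le_of_le _ (hreach _ hs s rfl) (by exact_mod_cast hs)
    · exact iInf₂_le_of_le 0 ((chainMDP_μ₀_pos idx a H D s).2 (.inr (by omega))) (by simp)
  · refine le_iSup_of_le (idx.symm ⟨D, by omega⟩) (le_iInf₂ fun k hk => ?_)
    have := hle k _ hk
    simp only [Equiv.apply_symm_apply, lt_self_iff_false, or_false] at this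
    exact_mod_cast this

/-- With target action `a` everywhere, ranked last at first, each of the `n (|A| - 1)` demotions
outside the sink costs an episode, as it is followed by a transition to the sink. -/
theorem le_METaL_chainMDP [Fintype S] [Fintype A] [DecidableEq A] {n : ℕ} (idx : S ≃ Fin (n + 1))
    {L : Learner S A} (hε : L.ε = 0) (a : A) (H : ℕ) {D : ℕ} (hD : D < n) :
    ((n * (Fintype.card A - 1) - 1) * H : ℕ) ≤
      METaL (chainMDP idx a H D) L (worstTable S a) fun _ => a := by
  classical
  by_cases hpos : n * (Fintype.card A - 1) = 0
  · simp [hpos]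
  set sink : S := idx.symm (Fin.last n)
  refine le_METaL hε
    (fun Q s => ∑ x ∈ Finset.univ.erase sink, numAbove a Q x + if s = sink then 1 else 0)
    ?_ ?_ ?_ ?_
  · intro Q s r s' hP
    have hsink : ∀ x, x = sink ↔ (idx x : ℕ) = n := fun x => by
      rw [Equiv.eq_symm_apply, Fin.ext_iff, Fin.val_last]
    rw [chainMDP_P_pos idx a H hD] at hP
    set e : Experience S A := ⟨s, L.greedy Q s, r, s'⟩ with he
    have hne : ∀ x, x ≠ s → numAbove a Q x = numAbove a (L.update Q e) x := fun x hx =>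
      (numAbove_update_of_ne L a Q hx).symm
    by_cases hs : s = sink
    · have hs' : s' = sink := by
        rw [hsink] at hs ⊢
        rw [hP, if_neg]
        omega
      rw [if_pos hs, if_pos hs']
      refine Nat.add_le_add_right (Finset.sum_le_sum fun x hx => (hne x ?_).le) 1
      exact hs ▸ Finset.ne_of_mem_erase hx
    · rw [if_neg hs, add_zero]
      by_cases ha : L.greedy Q s = a
      · refine le_trans (Finset.sum_le_sum fun x _ => ?_) (Nat.le_add_right _ _)
        by_cases hx : x = s
        · have := numAbove_greedy L Q s
          rw [ha] at this
          rw [hx, this]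
          exact Nat.zero_le _
        · exact (hne x hx).le
      · rw [if_neg fun h => ha h.1, ← hsink] at hP
        have hmem : s ∈ Finset.univ.erase sink := Finset.mem_erase.2 ⟨hs, Finset.mem_univ s⟩
        have hsum : ∑ x ∈ (Finset.univ.erase sink).erase s, numAbove a Q x =
            ∑ x ∈ (Finset.univ.erase sink).erase s, numAbove a (L.update Q e) x :=
          Finset.sum_congr rfl fun x hx => hne x (Finset.ne_of_mem_erase hx)
        rw [if_pos hP, ← Finset.add_sum_erase _ (fun x => numAbove a Q x) hmem, hsum,
          ← Finset.add_sum_erase _ (fun x => numAbove a (L.update Q e) x) hmem]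
        have := numAbove_le_update_add_one L Q (e := e) (Ne.symm ha) s
        omega
  · intro Q s s'
    split_ifs <;> omega
  · intro s
    have hcard : Fintype.card S = n + 1 := by rw [Fintype.card_congr idx, Fintype.card_fin]
    simp only [numAbove_worstTable, Finset.sum_const, smul_eq_mul,
      Finset.card_erase_of_mem (Finset.mem_univ sink), Finset.card_univ, hcard,
      Nat.add_sub_cancel]
    omega
  · intro Q s hL
    have h : ∀ x, numAbove a Q x = 0 := fun x => by
      have := numAbove_greedy L Q x
      rwa [hL] at this
    simp only [h, Finset.sum_const_zero]
    split_ifs <;> omega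

theorem le_TDim_of_mem [Fintype A] {L : Learner S A} {F : Set (MDP S A)} {M : MDP S A}
    (hM : M ∈ F) (Q₀ : QTable S A) (π : S → A) : METaL M L Q₀ π ≤ TDim L F :=
  le_iSup_of_le π (le_iSup_of_le Q₀ (le_iSup₂_of_le M hM le_rfl))

theorem exists_le_TDim [Fintype S] [Fintype A] {L : Learner S A} (hε : L.ε = 0) (H : ℕ) {D : ℕ}
    (hA : 2 ≤ Fintype.card A) (hS : D + 2 ≤ Fintype.card S) :
    ∃ K : ℕ, Fintype.card S * Fintype.card A ≤ 8 * K ∧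
      (K * H : ℕ) ≤ TDim L (mdpFamily S A H D) := by
  classical
  obtain ⟨n, hn⟩ : ∃ n, Fintype.card S = n + 1 := ⟨Fintype.card S - 1, by omega⟩
  obtain ⟨m, hm⟩ : ∃ m, Fintype.card A = m + 1 := ⟨Fintype.card A - 1, by omega⟩
  have : Nonempty S := Fintype.card_pos_iff.1 (by omega)
  have : Nonempty A := Fintype.card_pos_iff.1 (by omega)
  obtain ⟨a⟩ := ‹Nonempty A›
  -- For `|S| = |A| = 2` the chain is a single state, and one episode teaches it and the sink.
  by_cases h1 : n = 1 ∧ m = 1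
  · obtain ⟨rfl, rfl⟩ := h1
    obtain rfl : D = 0 := by omega
    refine ⟨1, by simp [hn, hm], ?_⟩
    have h := le_METaL_absorbingMDP (S := S) hA hε H a
    rw [hn] at h
    exact h.trans (le_TDim_of_mem (F := mdpFamily S A H 0)
      ⟨rfl, by simpa using absorbingMDP_diameter H⟩ _ _)
  · have hD : D < n := by omega
    refine ⟨n * m - 1, ?_, ?_⟩
    · have hn1 : 1 ≤ n := by omega
      have hm1 : 1 ≤ m := by omega
      have h2 : 2 ≤ n * m := by
        by_contra hlt
        have h : n * m = 1 := le_antisymm (by omega) (Nat.mul_pos hn1 hm1)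
        exact h1 (mul_eq_one.1 h)
      have h3 : (n + 1) * (m + 1) ≤ (2 * n) * (2 * m) :=
        Nat.mul_le_mul (by omega) (by omega)
      rw [hn, hm]
      have h4 : (2 * n) * (2 * m) = 4 * (n * m) := by ring
      omega
    · have h := le_METaL_chainMDP (Fintype.equivFinOfCardEq hn) hε a H hD
      rw [hm, Nat.add_sub_cancel] at h
      exact h.trans (le_TDim_of_mem (F := mdpFamily S A H D) ⟨rfl, chainMDP_diameter _ a H hD⟩ _ _)

end RLTeaching

theorem corollary1 :
    ∃ c C : ℝ≥0, 0 < c ∧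
      ∀ (S A : Type*) [Fintype S] [Fintype A] (L : RLTeaching.Learner S A) (H D : ℕ),
        L.ε = 0 → D < H →
          RLTeaching.TDim L (RLTeaching.mdpFamily S A H D) ≤
              (C : ℝ≥0∞) * (Fintype.card S * Fintype.card A * H) ∧
          (2 ≤ Fintype.card A → D + 2 ≤ Fintype.card S →
            (c : ℝ≥0∞) * (Fintype.card S * Fintype.card A * H) ≤
              RLTeaching.TDim L (RLTeaching.mdpFamily S A H D)) := by
  refine ⟨8⁻¹, 2, by positivity, fun S A _ _ L H D hε hDH => ⟨?_, fun hA hS => ?_⟩⟩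
  · refine iSup_le fun π => iSup_le fun Q₀ => iSup₂_le fun M hM => ?_
    obtain ⟨rfl, hdiam⟩ := hM
    exact_mod_cast RLTeaching.METaL_le hε hdiam hDH Q₀ π
  · obtain ⟨K, hK, hle⟩ := RLTeaching.exists_le_TDim hε H hA hS
    refine le_trans ?_ hle
    have h : (Fintype.card S * Fintype.card A * H : ℝ≥0∞) ≤ 8 * (K * H : ℕ) := by
      have : Fintype.card S * Fintype.card A * H ≤ 8 * (K * H) :=
        (Nat.mul_le_mul_right H hK).trans_eq (mul_assoc _ _ _)
      exact_mod_cast this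
    rw [ENNReal.coe_inv (by norm_num), ENNReal.coe_ofNat]
    rw [← ENNReal.div_eq_inv_mul]
    exact ENNReal.div_le_of_le_mul' h
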